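/- For every integer $k$ there is a finite simple graph $G$ embedded in the plane with all faces (including the outer face) triangles, together with an orientation of its edges for which every vertex has equal in-degree and out-degree (an Eulerian oriented planar triangulation) and a proper colouring of its vertices with three colours, such that the following holds. Let $A$ be any set of vertices of $G$ such that the subdigraph of $G$ induced by $A$ is non-empty, connected (when the directions of its arcs are ignored) and contains no directed cycle, and such that $A$ is permeating, i.e. $A$ contains a vertex of the boundary of every face of $G$. Then $A$ contains at least $k$ vertices of each of the three colours. -/

import Mathlib

namespace OrientedPlane

variable {V : Type*}

/-- A directed graph is an oriented graph if it has no directed cycle of length one or two. -/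
def IsOriented (D : Digraph V) : Prop :=
  ∀ u v, D.Adj u v → ¬ D.Adj v u

/-- An oriented graph is Eulerian if its underlying graph is connected and at each vertex the
out-degree equals the in-degree. -/
def IsEulerian (D : Digraph V) : Prop :=
  D.toSimpleGraphInclusive.Connected ∧
    ∀ v, {w | D.Adj v w}.ncard = {w | D.Adj w v}.ncard

/-- A set of vertices is acyclic if the subdigraph that it induces contains no directed cycle
(a nonempty cyclic sequence of distinct vertices, each with an arc to the next one). -/
def IsAcyclicSet (D : Digraph V) (A : Set V) : Prop :=
  ¬ ∃ c : Cycle V, c ≠ Cycle.nil ∧ c.Nodup ∧ (∀ v ∈ c, v ∈ A) ∧ c.Chain D.Adj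

/-- A set of vertices is connected if it is nonempty and the subdigraph that it induces is
connected when the directions of the arcs are ignored. -/
def IsConnectedSet (D : Digraph V) (A : Set V) : Prop :=
  (D.toSimpleGraphInclusive.induce A).Connected

/-- A rotation system on a simple graph, that is, a combinatorial embedding of the graph into an
oriented surface: a permutation of the darts (directed edges) which, for each vertex, permutes
the darts leaving that vertex in a single cycle. -/
structure RotationSystem (G : SimpleGraph V) where
  /-- The next dart around the initial vertex. -/
  next : Equiv.Perm G.Dart
  /-- The next dart leaves the same vertex. -/
  fst_next : ∀ d, (next d).fst = d.fst
  /-- The darts that leave a vertex form a single cycle. -/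
  sameCycle : ∀ d e : G.Dart, d.fst = e.fst → next.SameCycle d e

namespace RotationSystem

variable {G : SimpleGraph V} (R : RotationSystem G)

/-- The successor of a dart along the boundary walk of the face at one side of it: traverse the
dart, then leave its end by the dart that follows the reversed dart in the rotation there. -/
def faceNext : Equiv.Perm G.Dart :=
  (SimpleGraph.Dart.symm_involutive (G := G)).toPerm.trans R.next

/-- The faces of the embedding: the cycles of the face permutation on the darts. (A graph without
edges has no face in this sense, so that it is not planar in the sense below.) -/
def Face : Type _ :=
  Quotient (Equiv.Perm.SameCycle.setoid R.faceNext)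

/-- The darts on the boundary walk of a face. -/
def faceDarts (f : R.Face) : Set G.Dart :=
  {d | (Quotient.mk (Equiv.Perm.SameCycle.setoid R.faceNext) d : R.Face) = f}

/-- The vertices on the boundary of a face. -/
def faceVertices (f : R.Face) : Set V :=
  {v | ∃ d ∈ R.faceDarts f, d.fst = v}

/-- An embedding of a finite connected graph is planar (an embedding into the sphere) if the
surface has Euler characteristic two: `|V| - |E| + |F| = 2`. -/
def IsPlanar : Prop :=
  G.Connected ∧ Nat.card V + Nat.card R.Face = G.edgeSet.ncard + 2

/-- Every face is a triangle. -/
def IsTriangulation : Prop :=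
  ∀ f : R.Face, (R.faceDarts f).ncard = 3

/-- A set of vertices is permeating if it intersects every face. -/
def IsPermeating (A : Set V) : Prop :=
  ∀ f : R.Face, (A ∩ R.faceVertices f).Nonempty

end RotationSystem

end OrientedPlane

open OrientedPlane

open OrientedPlane

/-! Call a set good if it is connected, acyclic and permeating. The heart of the matter is a
22-vertex coloured Eulerian triangulation, the gadget, whose outer face is a directed triangle and
in which every good set contains a vertex of colour 0 off that triangle
(`IsGood.exists_mem_gadget`). The gadget has another directed facial triangle, disjoint from the
outer one.

Insert the gadget into a directed facial triangle of a larger triangulation, so that the two share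
exactly this triangle. A good set of the result must meet the triangle: otherwise connectedness
confines it strictly to one side, and it misses faces on the other. As the triangle is a clique, the
traces of the set on the two sides stay connected, hence good (`IsGluing.isGood_left`,
`IsGluing.isGood_right`). Thus the old lower bounds survive and the gadget contributes a new vertex
of one colour, which can be prescribed by rotating the triangle. The inner triangle of the gadget is
ready for the next insertion, so all three bounds can be raised indefinitely. -/

namespace OrientedPlane

/-! ### Triangulations as ternary face relations, and their rotation systems -/

section

variable {V : Type*}

/-- Two vertices are linked if there is an arc between them in one of the two directions. -/
def Linked (D : Digraph V) (u v : V) : Prop :=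
  D.Adj u v ∨ D.Adj v u

theorem Linked.symm {D : Digraph V} {u v : V} (h : Linked D u v) : Linked D v u :=
  Or.symm h

/-- A digraph `D` with a ternary relation `F` of oriented facial triangles that describes an
Eulerian oriented triangulation of the sphere: `F a b c` says that the rotation at `b` sends
`a` to `c`. -/
structure IsEulerianTriangulation (D : Digraph V) (F : V → V → V → Prop) : Prop where
  oriented : IsOriented D
  rotate : ∀ {a b c}, F a b c → F b c a
  linked : ∀ {a b c}, F a b c → Linked D a b
  exists_face : ∀ {a b}, Linked D a b → ∃ c, F a b c
  face_unique : ∀ {a b c c'}, F a b c → F a b c' → c = c'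
  -- The turns at a vertex form one cycle through all its neighbours, so the surface has no pinch
  -- point.
  link_connected : ∀ (v : V) (S : Set V), (∃ a ∈ S, Linked D v a) →
    (∀ a c, F a v c → a ∈ S → c ∈ S) → ∀ a, Linked D v a → a ∈ S
  connected : ∀ S : Set V, S.Nonempty → (∀ u ∈ S, ∀ v, Linked D u v → v ∈ S) → ∀ v, v ∈ S
  balanced : ∀ v, {w | D.Adj v w}.ncard = {w | D.Adj w v}.ncard
  -- Euler's formula for a triangulation, `|E| = 3|V| - 6`, free of truncated subtraction.
  card_arcs : {p : V × V | D.Adj p.1 p.2}.ncard + 6 = 3 * Nat.card V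

/-- The sets of the theorem: nonempty and connected, acyclic, and meeting every facial
triangle. -/
structure IsGood (D : Digraph V) (F : V → V → V → Prop) (A : Set V) : Prop where
  nonempty : A.Nonempty
  connected : ∀ S ⊆ A, S.Nonempty → (∀ u ∈ S, ∀ v ∈ A, Linked D u v → v ∈ S) → A ⊆ S
  acyclic : IsAcyclicSet D A
  permeating : ∀ {a b c}, F a b c → a ∈ A ∨ b ∈ A ∨ c ∈ A

theorem linked_ne {D : Digraph V} (h : IsOriented D) {u v : V} (huv : Linked D u v) : u ≠ v := by
  rintro rfl
  rcases huv with huv | huv <;> exact h _ _ huv huv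

theorem toSimpleGraphInclusive_adj_iff {D : Digraph V} (h : IsOriented D) {u v : V} :
    D.toSimpleGraphInclusive.Adj u v ↔ Linked D u v := by
  unfold Digraph.toSimpleGraphInclusive
  rw [SimpleGraph.fromRel_adj]
  exact ⟨fun h => h.2, fun huv => ⟨linked_ne h huv, huv⟩⟩

theorem connected_of_closed_sets [Nonempty V] {G : SimpleGraph V}
    (h : ∀ S : Set V, S.Nonempty → (∀ u ∈ S, ∀ v, G.Adj u v → v ∈ S) → ∀ v, v ∈ S) :
    G.Connected := by
  refine ⟨fun u v => ?_⟩
  exact h {w | G.Reachable u w} ⟨u, SimpleGraph.Reachable.refl u⟩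
    (fun a ha b hab => ha.trans hab.reachable) v

theorem IsConnectedSet.subset_of_closed {D : Digraph V} {A S : Set V}
    (hA : IsConnectedSet D A) (ho : IsOriented D) (hS : S.Nonempty) (hSA : S ⊆ A)
    (hcl : ∀ u ∈ S, ∀ v ∈ A, Linked D u v → v ∈ S) : A ⊆ S := by
  intro v hv
  obtain ⟨u, hu⟩ := hS
  obtain ⟨w⟩ := hA.preconnected ⟨u, hSA hu⟩ ⟨v, hv⟩
  have key : ∀ (x y : A), (D.toSimpleGraphInclusive.induce A).Walk x y → x.1 ∈ S → y.1 ∈ S := by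
    intro x y w
    induction w with
    | nil => exact id
    | cons hadj _ ih =>
      intro hx
      exact ih (hcl _ hx _ (Subtype.prop _) ((toSimpleGraphInclusive_adj_iff ho).1 hadj))
  exact key _ _ w hu

namespace IsEulerianTriangulation

variable {D : Digraph V} {F : V → V → V → Prop}

theorem dart_linked (h : IsEulerianTriangulation D F) (d : D.toSimpleGraphInclusive.Dart) :
    Linked D d.fst d.snd :=
  (toSimpleGraphInclusive_adj_iff h.oriented).1 d.adj

theorem ncard_edgeSet (h : IsEulerianTriangulation D F) :
    D.toSimpleGraphInclusive.edgeSet.ncard = {p : V × V | D.Adj p.1 p.2}.ncard := by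
  have : D.toSimpleGraphInclusive.edgeSet =
      (fun p : V × V => s(p.1, p.2)) '' {p : V × V | D.Adj p.1 p.2} := by
    ext e
    induction e with
    | _ u v =>
    rw [SimpleGraph.mem_edgeSet, toSimpleGraphInclusive_adj_iff h.oriented]
    constructor
    · rintro (huv | huv)
      · exact ⟨(u, v), huv, rfl⟩
      · exact ⟨(v, u), huv, Sym2.eq_swap⟩
    · rintro ⟨⟨a, b⟩, hab, he⟩
      simp only [Sym2.eq_iff] at he
      rcases he with ⟨rfl, rfl⟩ | ⟨rfl, rfl⟩
      · exact Or.inl hab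
      · exact Or.inr hab
  rw [this, Set.InjOn.ncard_image]
  rintro ⟨a, b⟩ hab ⟨c, d⟩ hcd he
  simp only [Sym2.eq_iff] at he
  rcases he with ⟨rfl, rfl⟩ | ⟨rfl, rfl⟩
  · rfl
  · exact absurd hab (h.oriented _ _ hcd)

/-- The third vertex of the facial triangle to which an oriented edge belongs. -/
noncomputable def third (h : IsEulerianTriangulation D F) {a b : V} (hab : Linked D a b) : V :=
  (h.exists_face hab).choose

theorem face_third (h : IsEulerianTriangulation D F) {a b : V} (hab : Linked D a b) :
    F a b (h.third hab) :=
  (h.exists_face hab).choose_spec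

theorem third_eq (h : IsEulerianTriangulation D F) {a b c : V} (hab : Linked D a b)
    (habc : F a b c) : h.third hab = c :=
  h.face_unique (h.face_third hab) habc

/-- The rotation of the darts around their initial vertices. -/
noncomputable def nextDart (h : IsEulerianTriangulation D F) :
    Equiv.Perm D.toSimpleGraphInclusive.Dart where
  toFun d := ⟨(d.fst, h.third (h.dart_linked d).symm), (toSimpleGraphInclusive_adj_iff h.oriented).2
    (h.linked (h.rotate (h.face_third (h.dart_linked d).symm)))⟩
  invFun d := ⟨(d.fst, h.third (h.dart_linked d)), (toSimpleGraphInclusive_adj_iff h.oriented).2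
    (h.linked (h.rotate (h.rotate (h.face_third (h.dart_linked d))))).symm⟩
  left_inv d := by
    refine SimpleGraph.Dart.ext _ _ (Prod.ext rfl ?_)
    dsimp only
    exact h.third_eq _ (h.rotate (h.face_third (h.dart_linked d).symm))
  right_inv d := by
    refine SimpleGraph.Dart.ext _ _ (Prod.ext rfl ?_)
    dsimp only
    exact h.third_eq _ (h.rotate (h.rotate (h.face_third (h.dart_linked d))))

theorem face_nextDart (h : IsEulerianTriangulation D F) (d : D.toSimpleGraphInclusive.Dart) :
    F d.snd d.fst (h.nextDart d).snd :=
  h.face_third (h.dart_linked d).symm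

/-- The rotation system given by the facial triangles. -/
noncomputable def rotationSystem (h : IsEulerianTriangulation D F) :
    RotationSystem D.toSimpleGraphInclusive where
  next := h.nextDart
  fst_next _ := rfl
  sameCycle d e hde := by
    obtain ⟨e', h₁, h₂, h₃⟩ := h.link_connected d.fst
      {a | ∃ e, e.fst = d.fst ∧ e.snd = a ∧ h.nextDart.SameCycle d e}
      ⟨d.snd, ⟨d, rfl, rfl, Equiv.Perm.SameCycle.refl _ _⟩, h.dart_linked d⟩
      (by
        rintro a c hac ⟨e, h₁, rfl, h₃⟩
        rw [← h₁] at hac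
        exact ⟨h.nextDart e, h₁, h.face_unique (h.face_nextDart e) hac,
          Equiv.Perm.sameCycle_apply_right.2 h₃⟩)
      e.snd (hde ▸ h.dart_linked e)
    have : e' = e := SimpleGraph.Dart.ext _ _ (Prod.ext (h₁.trans hde) h₂)
    exact this ▸ h₃

theorem face_faceNext (h : IsEulerianTriangulation D F) (d : D.toSimpleGraphInclusive.Dart) :
    F d.fst d.snd (h.rotationSystem.faceNext d).snd :=
  h.face_nextDart d.symm

/-- The walk along `a b` leaves `b` for the `c` with `F a b c`; the rotated triples `F b c a` and `F
c a b` then force it back to its start. -/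
theorem faceNext_faceNext_faceNext (h : IsEulerianTriangulation D F)
    (d : D.toSimpleGraphInclusive.Dart) :
    h.rotationSystem.faceNext (h.rotationSystem.faceNext (h.rotationSystem.faceNext d)) = d := by
  have h₁ := h.face_faceNext d
  have h₂ := h.face_faceNext (h.rotationSystem.faceNext d)
  have h₃ := h.face_faceNext (h.rotationSystem.faceNext (h.rotationSystem.faceNext d))
  have e₂ := h.face_unique h₂ (h.rotate h₁)
  refine SimpleGraph.Dart.ext _ _ (Prod.ext e₂ ?_)
  change F (h.rotationSystem.faceNext d).snd
    (h.rotationSystem.faceNext (h.rotationSystem.faceNext d)).snd _ at h₃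
  rw [e₂] at h₃
  exact h.face_unique h₃ (h.rotate (h.rotate h₁))

theorem sameCycle_faceNext_iff (h : IsEulerianTriangulation D F)
    (d e : D.toSimpleGraphInclusive.Dart) :
    h.rotationSystem.faceNext.SameCycle d e ↔ e ∈ ({d, h.rotationSystem.faceNext d,
      h.rotationSystem.faceNext (h.rotationSystem.faceNext d)} : Set _) := by
  set f := h.rotationSystem.faceNext with hf
  have h3 : ∀ x, f (f (f x)) = x := h.faceNext_faceNext_faceNext
  constructor
  · rintro ⟨n, rfl⟩
    induction n with
    | zero => simp
    | succ n ih =>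
      rw [add_comm, zpow_add, zpow_one, Equiv.Perm.mul_apply]
      rcases ih with ih | ih | ih
      · rw [ih]; simp
      · rw [ih]; simp
      · rw [ih, h3]; simp
    | pred n ih =>
      rw [sub_eq_add_neg, add_comm, zpow_add, zpow_neg_one, Equiv.Perm.mul_apply]
      rcases ih with ih | ih | ih
      · rw [ih, Equiv.Perm.inv_eq_iff_eq.2 (h3 d).symm]; simp
      · rw [ih]; simp
      · rw [ih]; simp
  · rintro (rfl | rfl | rfl)
    · exact Equiv.Perm.SameCycle.refl _ _
    · exact Equiv.Perm.sameCycle_apply_right.2 (Equiv.Perm.SameCycle.refl _ _)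
    · exact Equiv.Perm.sameCycle_apply_right.2
        (Equiv.Perm.sameCycle_apply_right.2 (Equiv.Perm.SameCycle.refl _ _))

theorem faceDarts_mk (h : IsEulerianTriangulation D F) (d : D.toSimpleGraphInclusive.Dart) :
    h.rotationSystem.faceDarts
        (Quotient.mk (Equiv.Perm.SameCycle.setoid h.rotationSystem.faceNext) d) =
      {d, h.rotationSystem.faceNext d,
        h.rotationSystem.faceNext (h.rotationSystem.faceNext d)} := by
  ext e
  rw [← h.sameCycle_faceNext_iff d e]
  exact Quotient.eq.trans ⟨fun h => Equiv.Perm.SameCycle.symm h,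
    fun h => Equiv.Perm.SameCycle.symm h⟩

theorem isTriangulation (h : IsEulerianTriangulation D F) :
    h.rotationSystem.IsTriangulation := by
  intro f
  induction f using Quotient.inductionOn with
  | _ d =>
  rw [faceDarts_mk]
  have h₁ := h.face_faceNext d
  have hab := linked_ne h.oriented (h.linked h₁)
  have hbc := linked_ne h.oriented (h.linked (h.rotate h₁))
  have hca := linked_ne h.oriented (h.linked (h.rotate (h.rotate h₁)))
  rw [Set.ncard_eq_three]
  exact ⟨_, _, _, fun e => hab (congrArg (·.fst) e), fun e => hca (congrArg (·.fst) e).symm,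
    fun e => hbc (congrArg (·.fst) e), rfl⟩

/-- Counting darts by edges and by triangular faces gives `2|E| = 3|F|`, which with `card_arcs` is
Euler's formula. -/
theorem isPlanar [Finite V] [Nonempty V] (h : IsEulerianTriangulation D F) :
    h.rotationSystem.IsPlanar := by
  classical
  have := Fintype.ofFinite V
  refine ⟨connected_of_closed_sets fun S hS hcl => h.connected S hS fun u hu v huv =>
    hcl u hu v ((toSimpleGraphInclusive_adj_iff h.oriented).2 huv), ?_⟩
  have hdart : Nat.card D.toSimpleGraphInclusive.Dart =
      2 * D.toSimpleGraphInclusive.edgeSet.ncard := by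
    rw [Nat.card_eq_fintype_card, SimpleGraph.dart_card_eq_twice_card_edges,
      ← SimpleGraph.coe_edgeFinset, Set.ncard_coe_finset]
  have : Finite h.rotationSystem.Face := inferInstanceAs (Finite (Quotient _))
  have := Fintype.ofFinite h.rotationSystem.Face
  have hface : Nat.card D.toSimpleGraphInclusive.Dart = 3 * Nat.card h.rotationSystem.Face := by
    let q : D.toSimpleGraphInclusive.Dart → h.rotationSystem.Face := Quotient.mk _
    have hq : ∀ f, Nat.card {d // q d = f} = 3 := h.isTriangulation
    rw [Nat.card_congr (Equiv.sigmaFiberEquiv q).symm, Nat.card_sigma]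
    simp only [hq, Finset.sum_const, Finset.card_univ, smul_eq_mul, Nat.card_eq_fintype_card]
    exact Nat.mul_comm _ _
  have hedge := h.ncard_edgeSet
  have harcs := h.card_arcs
  omega

theorem isEulerian [Nonempty V] (h : IsEulerianTriangulation D F) : IsEulerian D :=
  ⟨connected_of_closed_sets fun S hS hcl => h.connected S hS fun u hu v huv =>
    hcl u hu v ((toSimpleGraphInclusive_adj_iff h.oriented).2 huv), h.balanced⟩

theorem isGood (h : IsEulerianTriangulation D F) {A : Set V} (hc : IsConnectedSet D A)
    (ha : IsAcyclicSet D A) (hp : h.rotationSystem.IsPermeating A) : IsGood D F A where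
  nonempty := Set.nonempty_coe_sort.1 hc.nonempty
  connected _ hSA hS hcl := hc.subset_of_closed h.oriented hS hSA hcl
  acyclic := ha
  permeating {a b c} habc := by
    let d : D.toSimpleGraphInclusive.Dart :=
      ⟨(a, b), (toSimpleGraphInclusive_adj_iff h.oriented).2 (h.linked habc)⟩
    obtain ⟨v, hv, e, he, rfl⟩ :=
      hp (Quotient.mk (Equiv.Perm.SameCycle.setoid h.rotationSystem.faceNext) d)
    rw [faceDarts_mk] at he
    rcases he with rfl | rfl | rfl
    · exact Or.inl hv
    · exact Or.inr (Or.inl hv)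
    · exact Or.inr (Or.inr (h.face_unique (h.face_faceNext d) habc ▸ hv))

end IsEulerianTriangulation

end

/-! ### Gluing two triangulations along a directed facial triangle -/

section

section Relation

variable {V X : Type*}

theorem setOf_map_left {r : V → V → Prop} {f : V → X} (hf : f.Injective) (a : V) :
    {q | Relation.Map r f f (f a) q} = f '' {b | r a b} := by
  ext q
  constructor
  · rintro ⟨a', b, hab, ha, rfl⟩
    exact ⟨b, hf ha ▸ hab, rfl⟩
  · rintro ⟨b, hab, rfl⟩
    exact ⟨a, b, hab, rfl, rfl⟩

theorem setOf_map_right {r : V → V → Prop} {f : V → X} (hf : f.Injective) (a : V) :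
    {q | Relation.Map r f f q (f a)} = f '' {b | r b a} := by
  ext q
  constructor
  · rintro ⟨b, a', hab, rfl, ha⟩
    exact ⟨b, hf ha ▸ hab, rfl⟩
  · rintro ⟨b, hab, rfl⟩
    exact ⟨b, a, hab, rfl, rfl⟩

theorem ncard_map_balanced {r : V → V → Prop} {f : V → X} (hf : f.Injective)
    (hr : ∀ a, {b | r a b}.ncard = {b | r b a}.ncard) (p : X) :
    {q | Relation.Map r f f p q}.ncard = {q | Relation.Map r f f q p}.ncard := by
  by_cases hp : p ∈ Set.range f
  · obtain ⟨a, rfl⟩ := hp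
    rw [setOf_map_left hf, setOf_map_right hf, Set.ncard_image_of_injective _ hf,
      Set.ncard_image_of_injective _ hf, hr]
  · have h₁ : {q | Relation.Map r f f p q} = ∅ := by
      ext q
      simp only [Set.mem_ofPred_eq, Set.mem_empty_iff_false, iff_false]
      rintro ⟨a, -, -, rfl, -⟩
      exact hp ⟨a, rfl⟩
    have h₂ : {q | Relation.Map r f f q p} = ∅ := by
      ext q
      simp only [Set.mem_ofPred_eq, Set.mem_empty_iff_false, iff_false]
      rintro ⟨-, a, -, -, rfl⟩
      exact hp ⟨a, rfl⟩
    rw [h₁, h₂]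

/-- Inclusion–exclusion: balance passes to a union once the common arcs are balanced too. -/
theorem ncard_or_balanced [Finite X] {r s : X → X → Prop}
    (hr : ∀ p, {q | r p q}.ncard = {q | r q p}.ncard)
    (hs : ∀ p, {q | s p q}.ncard = {q | s q p}.ncard)
    (hrs : ∀ p, {q | r p q ∧ s p q}.ncard = {q | r q p ∧ s q p}.ncard) (p : X) :
    {q | r p q ∨ s p q}.ncard = {q | r q p ∨ s q p}.ncard := by
  have h₁ := Set.ncard_union_add_ncard_inter {q | r p q} {q | s p q}
  have h₂ := Set.ncard_union_add_ncard_inter {q | r q p} {q | s q p}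
  have := hr p
  have := hs p
  have := hrs p
  simp only [Set.ofPred_or, Set.ofPred_and] at *
  omega

theorem ncard_setOf_map {r : V → V → Prop} {f : V → X} (hf : f.Injective) :
    {p : X × X | Relation.Map r f f p.1 p.2}.ncard = {p : V × V | r p.1 p.2}.ncard := by
  rw [← Set.ncard_image_of_injective _ (hf.prodMap hf)]
  congr 1
  ext ⟨p, q⟩
  constructor
  · rintro ⟨a, b, hab, rfl, rfl⟩
    exact ⟨(a, b), hab, rfl⟩
  · rintro ⟨⟨a, b⟩, hab, h⟩
    obtain ⟨rfl, rfl⟩ := Prod.mk.inj h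
    exact ⟨a, b, hab, rfl, rfl⟩

end Relation

variable {V U X : Type*}

/-- The union of two digraphs that are embedded into a common vertex set. -/
def glueDigraph (D : Digraph V) (E : Digraph U) (ι : V → X) (κ : U → X) : Digraph X where
  Adj p q := Relation.Map D.Adj ι ι p q ∨ Relation.Map E.Adj κ κ p q

/-- The facial triangles of two triangulations glued along the facial triangles `t` and `τ`,
which disappear. -/
def glueFace (F : V → V → V → Prop) (H : U → U → U → Prop) (ι : V → X) (κ : U → X)
    (t : Fin 3 → V) (τ : Fin 3 → U) (p q r : X) : Prop :=
  (∃ a b c, F a b c ∧ (¬ ∃ i, a = t i ∧ b = t (i + 1) ∧ c = t (i + 2)) ∧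
      ι a = p ∧ ι b = q ∧ ι c = r) ∨
    ∃ a b c, H a b c ∧ (¬ ∃ i, a = τ (i + 1) ∧ b = τ i ∧ c = τ (i + 2)) ∧
      κ a = p ∧ κ b = q ∧ κ c = r

/-- Two Eulerian oriented triangulations embedded into a common vertex set, whose intersection is
a directed triangle that bounds a face of both, on opposite sides. -/
structure IsGluing (D : Digraph V) (F : V → V → V → Prop) (E : Digraph U)
    (H : U → U → U → Prop) (ι : V → X) (κ : U → X) (t : Fin 3 → V) (τ : Fin 3 → U) : Prop where
  left : IsEulerianTriangulation D F
  right : IsEulerianTriangulation E H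
  inj_left : ι.Injective
  inj_right : κ.Injective
  cover : ∀ p, p ∈ Set.range ι ∨ p ∈ Set.range κ
  glue : ∀ i, ι (t i) = κ (τ i)
  overlap : ∀ {v u}, ι v = κ u → ∃ i, v = t i ∧ u = τ i
  arc_left : ∀ i, D.Adj (t i) (t (i + 1))
  arc_right : ∀ i, E.Adj (τ i) (τ (i + 1))
  face_left : ∀ i, F (t i) (t (i + 1)) (t (i + 2))
  face_right : ∀ i, H (τ (i + 1)) (τ i) (τ (i + 2))

theorem fin_three_cases (i j : Fin 3) : j = i ∨ j = i + 1 ∨ (j = i + 2 ∧ j + 1 = i) := by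
  revert i j
  decide

theorem fin_three_add (i : Fin 3) :
    i + 1 + 1 = i + 2 ∧ i + 1 + 2 = i ∧ i + 2 + 1 = i ∧ i + 2 + 2 = i + 1 := by
  revert i
  decide

theorem fin_three_ne (i : Fin 3) : i ≠ i + 1 ∧ i ≠ i + 2 := by
  revert i
  decide

theorem fin_three_absurd (i j : Fin 3) (h₁ : i = j + 1) (h₂ : i + 1 = j) : False := by
  revert i j
  decide

theorem directed_triangle_adj_iff {D : Digraph V} (h : IsOriented D) {t : Fin 3 → V}
    (ht : ∀ i, D.Adj (t i) (t (i + 1))) (i j : Fin 3) : D.Adj (t i) (t j) ↔ j = i + 1 := by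
  constructor
  · intro hij
    rcases fin_three_cases i j with hj | hj | ⟨-, hj⟩
    · subst hj
      exact absurd hij (h _ _ hij)
    · exact hj
    · exact absurd (hj ▸ ht j) (h _ _ hij)
  · rintro rfl
    exact ht i

theorem directed_triangle_linked {D : Digraph V} {t : Fin 3 → V}
    (ht : ∀ i, D.Adj (t i) (t (i + 1))) {i j : Fin 3} (hij : i ≠ j) : Linked D (t i) (t j) := by
  rcases fin_three_cases i j with hj | hj | ⟨-, hj⟩
  · exact absurd hj.symm hij
  · exact Or.inl (hj ▸ ht i)
  · exact Or.inr (hj ▸ ht j)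

theorem directed_triangle_injective {D : Digraph V} (h : IsOriented D) {t : Fin 3 → V}
    (ht : ∀ i, D.Adj (t i) (t (i + 1))) : t.Injective := by
  intro i j hij
  by_contra hne
  exact linked_ne h (directed_triangle_linked ht hne) hij

namespace IsGluing

variable {D : Digraph V} {F : V → V → V → Prop} {E : Digraph U} {H : U → U → U → Prop}
  {ι : V → X} {κ : U → X} {t : Fin 3 → V} {τ : Fin 3 → U}

theorem injective_left (h : IsGluing D F E H ι κ t τ) : t.Injective :=
  directed_triangle_injective h.left.oriented h.arc_left

theorem injective_right (h : IsGluing D F E H ι κ t τ) : τ.Injective :=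
  directed_triangle_injective h.right.oriented h.arc_right

theorem adj_and_adj (h : IsGluing D F E H ι κ t τ) (p q : X) :
    Relation.Map D.Adj ι ι p q ∧ Relation.Map E.Adj κ κ p q ↔
      Relation.Map (fun i j => j = i + 1) (ι ∘ t) (ι ∘ t) p q := by
  constructor
  · rintro ⟨⟨a, b, hab, rfl, rfl⟩, ⟨a', b', -, ha, hb⟩⟩
    obtain ⟨i, rfl, rfl⟩ := h.overlap ha.symm
    obtain ⟨j, rfl, rfl⟩ := h.overlap hb.symm
    exact ⟨i, j, (directed_triangle_adj_iff h.left.oriented h.arc_left i j).1 hab, rfl, rfl⟩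
  · rintro ⟨i, j, rfl, rfl, rfl⟩
    exact ⟨⟨_, _, h.arc_left i, rfl, rfl⟩, ⟨_, _, h.arc_right i, (h.glue _).symm,
      (h.glue _).symm⟩⟩

/-- Gluing creates no arc between old vertices, since both sides direct the shared triangle alike.
-/
theorem adj_left (h : IsGluing D F E H ι κ t τ) {a b : V} :
    (glueDigraph D E ι κ).Adj (ι a) (ι b) ↔ D.Adj a b := by
  constructor
  · rintro (⟨a', b', hab, ha, hb⟩ | ⟨a', b', hab, ha, hb⟩)
    · rwa [← h.inj_left ha, ← h.inj_left hb]
    · obtain ⟨i, rfl, rfl⟩ := h.overlap ha.symm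
      obtain ⟨j, rfl, rfl⟩ := h.overlap hb.symm
      rw [directed_triangle_adj_iff h.right.oriented h.arc_right] at hab
      rwa [directed_triangle_adj_iff h.left.oriented h.arc_left]
  · exact fun hab => Or.inl ⟨a, b, hab, rfl, rfl⟩

theorem adj_right (h : IsGluing D F E H ι κ t τ) {a b : U} :
    (glueDigraph D E ι κ).Adj (κ a) (κ b) ↔ E.Adj a b := by
  constructor
  · rintro (⟨a', b', hab, ha, hb⟩ | ⟨a', b', hab, ha, hb⟩)
    · obtain ⟨i, rfl, rfl⟩ := h.overlap ha
      obtain ⟨j, rfl, rfl⟩ := h.overlap hb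
      rw [directed_triangle_adj_iff h.left.oriented h.arc_left] at hab
      rwa [directed_triangle_adj_iff h.right.oriented h.arc_right]
    · rwa [← h.inj_right ha, ← h.inj_right hb]
  · exact fun hab => Or.inr ⟨a, b, hab, rfl, rfl⟩

theorem linked_left (h : IsGluing D F E H ι κ t τ) {a b : V} :
    Linked (glueDigraph D E ι κ) (ι a) (ι b) ↔ Linked D a b :=
  or_congr h.adj_left h.adj_left

theorem linked_right (h : IsGluing D F E H ι κ t τ) {a b : U} :
    Linked (glueDigraph D E ι κ) (κ a) (κ b) ↔ Linked E a b :=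
  or_congr h.adj_right h.adj_right

theorem exists_of_linked {p q : X} (hpq : Linked (glueDigraph D E ι κ) p q) :
    (∃ a b, Linked D a b ∧ ι a = p ∧ ι b = q) ∨ ∃ a b, Linked E a b ∧ κ a = p ∧ κ b = q := by
  rcases hpq with (⟨a, b, hab, ha, hb⟩ | ⟨a, b, hab, ha, hb⟩) |
    (⟨a, b, hab, ha, hb⟩ | ⟨a, b, hab, ha, hb⟩)
  · exact Or.inl ⟨a, b, Or.inl hab, ha, hb⟩
  · exact Or.inr ⟨a, b, Or.inl hab, ha, hb⟩
  · exact Or.inl ⟨b, a, Or.inr hab, hb, ha⟩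
  · exact Or.inr ⟨b, a, Or.inr hab, hb, ha⟩

theorem oriented (h : IsGluing D F E H ι κ t τ) : IsOriented (glueDigraph D E ι κ) := by
  rintro p q (⟨a, b, hab, rfl, rfl⟩ | ⟨a, b, hab, rfl, rfl⟩)
  · rw [h.adj_left]
    exact h.left.oriented _ _ hab
  · rw [h.adj_right]
    exact h.right.oriented _ _ hab

theorem rotate (h : IsGluing D F E H ι κ t τ) {p q r : X} (hf : glueFace F H ι κ t τ p q r) :
    glueFace F H ι κ t τ q r p := by
  rcases hf with ⟨a, b, c, hf, hn, rfl, rfl, rfl⟩ | ⟨a, b, c, hf, hn, rfl, rfl, rfl⟩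
  · refine Or.inl ⟨b, c, a, h.left.rotate hf, ?_, rfl, rfl, rfl⟩
    rintro ⟨i, rfl, rfl, rfl⟩
    exact hn ⟨i + 2, rfl, by rw [(fin_three_add i).2.2.1], by rw [(fin_three_add i).2.2.2]⟩
  · refine Or.inr ⟨b, c, a, h.right.rotate hf, ?_, rfl, rfl, rfl⟩
    rintro ⟨i, rfl, rfl, rfl⟩
    exact hn ⟨i + 1, by rw [(fin_three_add i).1], rfl, by rw [(fin_three_add i).2.1]⟩

theorem linked (h : IsGluing D F E H ι κ t τ) {p q r : X} (hf : glueFace F H ι κ t τ p q r) :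
    Linked (glueDigraph D E ι κ) p q := by
  rcases hf with ⟨a, b, c, hf, hn, rfl, rfl, rfl⟩ | ⟨a, b, c, hf, hn, rfl, rfl, rfl⟩
  · exact h.linked_left.2 (h.left.linked hf)
  · exact h.linked_right.2 (h.right.linked hf)

theorem exists_face_across_left (h : IsGluing D F E H ι κ t τ) (i : Fin 3) :
    ∃ c, glueFace F H ι κ t τ (ι (t (i + 1))) (ι (t i)) (ι c) := by
  obtain ⟨c, hc⟩ := h.left.exists_face (Or.inr (h.arc_left i))
  refine ⟨c, Or.inl ⟨_, _, _, hc, ?_, rfl, rfl, rfl⟩⟩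
  rintro ⟨k, h₁, h₂, -⟩
  exact fin_three_absurd k i (h.injective_left h₁).symm (h.injective_left h₂).symm

theorem exists_face_across_right (h : IsGluing D F E H ι κ t τ) (i : Fin 3) :
    ∃ c, glueFace F H ι κ t τ (κ (τ i)) (κ (τ (i + 1))) (κ c) := by
  obtain ⟨c, hc⟩ := h.right.exists_face (Or.inl (h.arc_right i))
  refine ⟨c, Or.inr ⟨_, _, _, hc, ?_, rfl, rfl, rfl⟩⟩
  rintro ⟨k, h₁, h₂, -⟩
  exact fin_three_absurd i k (h.injective_right h₁) (h.injective_right h₂)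

theorem exists_face_triangle (h : IsGluing D F E H ι κ t τ) {i j : Fin 3} (hij : i ≠ j) :
    ∃ r, glueFace F H ι κ t τ (ι (t i)) (ι (t j)) r := by
  rcases fin_three_cases i j with hj | rfl | ⟨-, rfl⟩
  · exact absurd hj.symm hij
  · obtain ⟨c, hc⟩ := h.exists_face_across_right i
    rw [← h.glue, ← h.glue] at hc
    exact ⟨_, hc⟩
  · obtain ⟨c, hc⟩ := h.exists_face_across_left j
    exact ⟨_, hc⟩

theorem exists_face (h : IsGluing D F E H ι κ t τ) {p q : X}
    (hpq : Linked (glueDigraph D E ι κ) p q) : ∃ r, glueFace F H ι κ t τ p q r := by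
  rcases exists_of_linked hpq with ⟨a, b, hab, rfl, rfl⟩ | ⟨a, b, hab, rfl, rfl⟩
  · by_cases htri : ∃ i j, a = t i ∧ b = t j
    · obtain ⟨i, j, rfl, rfl⟩ := htri
      exact h.exists_face_triangle fun hij => linked_ne h.left.oriented hab (congrArg t hij)
    · obtain ⟨c, hc⟩ := h.left.exists_face hab
      exact ⟨ι c, Or.inl ⟨a, b, c, hc, fun ⟨i, h₁, h₂, _⟩ => htri ⟨i, i + 1, h₁, h₂⟩,
        rfl, rfl, rfl⟩⟩
  · by_cases htri : ∃ i j, a = τ i ∧ b = τ j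
    · obtain ⟨i, j, rfl, rfl⟩ := htri
      rw [← h.glue, ← h.glue]
      exact h.exists_face_triangle fun hij => linked_ne h.right.oriented hab (congrArg τ hij)
    · obtain ⟨c, hc⟩ := h.right.exists_face hab
      exact ⟨κ c, Or.inr ⟨a, b, c, hc, fun ⟨i, h₁, h₂, _⟩ => htri ⟨i + 1, i, h₁, h₂⟩,
        rfl, rfl, rfl⟩⟩

/-- Each oriented edge of the shared triangle had a face on either side, but one of these was the
deleted triangle. -/
theorem not_left_and_right (h : IsGluing D F E H ι κ t τ) {a b c : V} {a' b' c' : U}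
    (hf : F a b c) (hn : ¬ ∃ i, a = t i ∧ b = t (i + 1) ∧ c = t (i + 2))
    (hf' : H a' b' c') (hn' : ¬ ∃ i, a' = τ (i + 1) ∧ b' = τ i ∧ c' = τ (i + 2))
    (ha : ι a = κ a') (hb : ι b = κ b') : False := by
  obtain ⟨i, rfl, rfl⟩ := h.overlap ha
  obtain ⟨j, rfl, rfl⟩ := h.overlap hb
  rcases fin_three_cases i j with hj | rfl | ⟨hj', rfl⟩
  · exact linked_ne h.left.oriented (h.left.linked hf) (congrArg t hj.symm)
  · exact hn ⟨i, rfl, rfl, h.left.face_unique hf (h.face_left i)⟩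
  · exact hn' ⟨j, rfl, rfl, h.right.face_unique hf' (h.face_right j)⟩

theorem face_unique (h : IsGluing D F E H ι κ t τ) {p q r r' : X}
    (hf : glueFace F H ι κ t τ p q r) (hf' : glueFace F H ι κ t τ p q r') : r = r' := by
  rcases hf with ⟨a, b, c, hf, hn, rfl, rfl, rfl⟩ | ⟨a, b, c, hf, hn, rfl, rfl, rfl⟩ <;>
    rcases hf' with ⟨a', b', c', hf', hn', ha, hb, rfl⟩ | ⟨a', b', c', hf', hn', ha, hb, rfl⟩
  · rw [h.inj_left ha, h.inj_left hb] at hf'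
    rw [h.left.face_unique hf hf']
  · exact (h.not_left_and_right hf hn hf' hn' ha.symm hb.symm).elim
  · exact (h.not_left_and_right hf' hn' hf hn ha hb).elim
  · rw [h.inj_right ha, h.inj_right hb] at hf'
    rw [h.right.face_unique hf hf']

/-- The hypothesis `htri` stands in for the turn that is lost at `v` with the deleted face. -/
theorem neighbors_left (h : IsGluing D F E H ι κ t τ) {S : Set X} {v : V}
    (hcl : ∀ p r, glueFace F H ι κ t τ p (ι v) r → p ∈ S → r ∈ S)
    (htri : ∀ i, v = t (i + 1) → ι (t i) ∈ S → ι (t (i + 2)) ∈ S)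
    (hS : ∃ a, Linked D v a ∧ ι a ∈ S) {a : V} (ha : Linked D v a) : ι a ∈ S := by
  obtain ⟨b, hb, hbS⟩ := hS
  refine h.left.link_connected v (ι ⁻¹' S) ⟨b, hbS, hb⟩ ?_ a ha
  intro a c hac haS
  by_cases hn : ∃ i, a = t i ∧ v = t (i + 1) ∧ c = t (i + 2)
  · obtain ⟨i, rfl, hv, rfl⟩ := hn
    exact htri i hv haS
  · exact hcl _ _ (Or.inl ⟨a, v, c, hac, hn, rfl, rfl, rfl⟩) haS

theorem neighbors_right (h : IsGluing D F E H ι κ t τ) {S : Set X} {v : U}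
    (hcl : ∀ p r, glueFace F H ι κ t τ p (κ v) r → p ∈ S → r ∈ S)
    (htri : ∀ i, v = τ i → κ (τ (i + 1)) ∈ S → κ (τ (i + 2)) ∈ S)
    (hS : ∃ a, Linked E v a ∧ κ a ∈ S) {a : U} (ha : Linked E v a) : κ a ∈ S := by
  obtain ⟨b, hb, hbS⟩ := hS
  refine h.right.link_connected v (κ ⁻¹' S) ⟨b, hbS, hb⟩ ?_ a ha
  intro a c hac haS
  by_cases hn : ∃ i, a = τ (i + 1) ∧ v = τ i ∧ c = τ (i + 2)
  · obtain ⟨i, rfl, hv, rfl⟩ := hn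
    exact htri i hv haS
  · exact hcl _ _ (Or.inr ⟨a, v, c, hac, hn, rfl, rfl, rfl⟩) haS

/-- Deleting the shared face opens the rotation at its vertex on each side into a path between the
other two triangle vertices; the two paths join into a single cycle. -/
theorem link_connected_triangle (h : IsGluing D F E H ι κ t τ) (k : Fin 3) {S : Set X}
    (hS : ∃ p ∈ S, Linked (glueDigraph D E ι κ) (ι (t k)) p)
    (hcl : ∀ p r, glueFace F H ι κ t τ p (ι (t k)) r → p ∈ S → r ∈ S) {p : X}
    (hp : Linked (glueDigraph D E ι κ) (ι (t k)) p) : p ∈ S := by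
  have h1 : k ≠ k + 1 := (fin_three_ne k).1
  have h2 : k ≠ k + 2 := (fin_three_ne k).2
  have left : (ι (t (k + 2)) ∈ S → ι (t (k + 1)) ∈ S) →
      (∃ a, Linked D (t k) a ∧ ι a ∈ S) → ∀ {a}, Linked D (t k) a → ι a ∈ S := by
    intro htri
    refine h.neighbors_left hcl ?_
    intro i hi
    obtain rfl := h.injective_left hi
    rwa [(fin_three_add i).1, (fin_three_add i).2.1] at htri
  have right : (ι (t (k + 1)) ∈ S → ι (t (k + 2)) ∈ S) →
      (∃ a, Linked E (τ k) a ∧ κ a ∈ S) → ∀ {a}, Linked E (τ k) a → κ a ∈ S := by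
    intro htri
    refine h.neighbors_right (h.glue k ▸ hcl) ?_
    intro i hi
    obtain rfl := h.injective_right hi
    rwa [← h.glue, ← h.glue]
  -- If `t (k + 1)` is not in `S`, the missing right-hand turn is vacuous, so `S` has no neighbour
  -- on the right, in particular not `t (k + 2)`. Then the left-hand turn is vacuous as well, and
  -- `S` has no neighbour at all.
  have all : ι (t (k + 1)) ∈ S := by
    by_contra hk1
    have hno : ¬ ∃ a, Linked E (τ k) a ∧ κ a ∈ S := fun hex =>
      hk1 (h.glue (k + 1) ▸ right (fun hh => absurd hh hk1) hex
        (directed_triangle_linked h.arc_right h1))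
    have hk2 : ι (t (k + 2)) ∉ S := fun hk2 =>
      hno ⟨_, directed_triangle_linked h.arc_right h2, h.glue (k + 2) ▸ hk2⟩
    obtain ⟨q, hq, hlq⟩ := hS
    rcases exists_of_linked hlq with ⟨a, b, hab, ha, rfl⟩ | ⟨a, b, hab, ha, rfl⟩
    · rw [h.inj_left ha] at hab
      exact hk1 (left (fun hh => absurd hh hk2) ⟨b, hab, hq⟩
        (directed_triangle_linked h.arc_left h1))
    · rw [h.inj_right (ha.trans (h.glue k))] at hab
      exact hno ⟨b, hab, hq⟩
  have hl : ∀ {a}, Linked D (t k) a → ι a ∈ S :=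
    left (fun _ => all) ⟨_, directed_triangle_linked h.arc_left h1, all⟩
  rcases exists_of_linked hp with ⟨a, b, hab, ha, rfl⟩ | ⟨a, b, hab, ha, rfl⟩
  · rw [h.inj_left ha] at hab
    exact hl hab
  · rw [h.inj_right (ha.trans (h.glue k))] at hab
    exact right (fun _ => hl (directed_triangle_linked h.arc_left h2))
      ⟨_, directed_triangle_linked h.arc_right h1, h.glue (k + 1) ▸ all⟩ hab

theorem link_connected (h : IsGluing D F E H ι κ t τ) (v : X) (S : Set X)
    (hS : ∃ p ∈ S, Linked (glueDigraph D E ι κ) v p)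
    (hcl : ∀ p r, glueFace F H ι κ t τ p v r → p ∈ S → r ∈ S) (p : X)
    (hp : Linked (glueDigraph D E ι κ) v p) : p ∈ S := by
  by_cases hv : ∃ k, v = ι (t k)
  · obtain ⟨k, rfl⟩ := hv
    exact h.link_connected_triangle k hS hcl hp
  rcases h.cover v with ⟨u, rfl⟩ | ⟨u, rfl⟩
  · have key : ∀ p, Linked (glueDigraph D E ι κ) (ι u) p → ∃ a, Linked D u a ∧ ι a = p := by
      intro p hp
      rcases exists_of_linked hp with ⟨a, b, hab, ha, rfl⟩ | ⟨a, b, hab, ha, rfl⟩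
      · exact ⟨b, h.inj_left ha ▸ hab, rfl⟩
      · obtain ⟨i, rfl, -⟩ := h.overlap ha.symm
        exact absurd ⟨i, rfl⟩ hv
    obtain ⟨q, hqS, hq⟩ := hS
    obtain ⟨b, hb, rfl⟩ := key q hq
    obtain ⟨a, ha, rfl⟩ := key p hp
    exact h.neighbors_left hcl (fun i hi => absurd ⟨_, congrArg ι hi⟩ hv) ⟨b, hb, hqS⟩ ha
  · have key : ∀ p, Linked (glueDigraph D E ι κ) (κ u) p → ∃ a, Linked E u a ∧ κ a = p := by
      intro p hp
      rcases exists_of_linked hp with ⟨a, b, hab, ha, rfl⟩ | ⟨a, b, hab, ha, rfl⟩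
      · obtain ⟨i, -, rfl⟩ := h.overlap ha
        exact absurd ⟨i, (h.glue i).symm⟩ hv
      · exact ⟨b, h.inj_right ha ▸ hab, rfl⟩
    obtain ⟨q, hqS, hq⟩ := hS
    obtain ⟨b, hb, rfl⟩ := key q hq
    obtain ⟨a, ha, rfl⟩ := key p hp
    exact h.neighbors_right hcl
      (fun i hi => absurd ⟨i, (congrArg κ hi).trans (h.glue i).symm⟩ hv) ⟨b, hb, hqS⟩ ha

theorem connected (h : IsGluing D F E H ι κ t τ) (S : Set X) (hS : S.Nonempty)
    (hcl : ∀ p ∈ S, ∀ q, Linked (glueDigraph D E ι κ) p q → q ∈ S) (p : X) : p ∈ S := by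
  have hl : (ι ⁻¹' S).Nonempty → ∀ a, ι a ∈ S := fun hne =>
    h.left.connected (ι ⁻¹' S) hne fun u hu v huv => hcl _ hu _ (h.linked_left.2 huv)
  have hr : (κ ⁻¹' S).Nonempty → ∀ a, κ a ∈ S := fun hne =>
    h.right.connected (κ ⁻¹' S) hne fun u hu v huv => hcl _ hu _ (h.linked_right.2 huv)
  have h0 : ι (t 0) ∈ S := by
    obtain ⟨q, hq⟩ := hS
    rcases h.cover q with ⟨a, rfl⟩ | ⟨a, rfl⟩
    · exact hl ⟨a, hq⟩ _
    · exact h.glue 0 ▸ hr ⟨a, hq⟩ _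
  rcases h.cover p with ⟨a, rfl⟩ | ⟨a, rfl⟩
  · exact hl ⟨_, h0⟩ a
  · exact hr ⟨τ 0, show κ (τ 0) ∈ S from h.glue 0 ▸ h0⟩ a

/-- The arcs counted twice form a directed triangle, which is itself balanced. -/
theorem balanced [Finite X] (h : IsGluing D F E H ι κ t τ) (p : X) :
    {q | (glueDigraph D E ι κ).Adj p q}.ncard = {q | (glueDigraph D E ι κ).Adj q p}.ncard := by
  refine ncard_or_balanced (ncard_map_balanced h.inj_left h.left.balanced)
    (ncard_map_balanced h.inj_right h.right.balanced) ?_ p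
  intro p
  simp only [h.adj_and_adj]
  refine ncard_map_balanced (h.inj_left.comp h.injective_left) ?_ p
  intro i
  rw [show {j : Fin 3 | j = i + 1} = {i + 1} from rfl,
    show {j : Fin 3 | i = j + 1} = {i + 2} by ext j; revert i j; decide,
    Set.ncard_singleton, Set.ncard_singleton]

/-- Three vertices and three arcs are shared, so `3|V| - |E|` becomes `6 + 6 - 9 + 3 = 6`. -/
theorem card_arcs [Finite X] (h : IsGluing D F E H ι κ t τ) :
    {p : X × X | (glueDigraph D E ι κ).Adj p.1 p.2}.ncard + 6 = 3 * Nat.card X := by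
  have := Finite.of_injective ι h.inj_left
  have := Finite.of_injective κ h.inj_right
  have hT := h.inj_left.comp h.injective_left
  have e₁ := Set.ncard_union_add_ncard_inter {p : X × X | Relation.Map D.Adj ι ι p.1 p.2}
    {p : X × X | Relation.Map E.Adj κ κ p.1 p.2}
  rw [← Set.ofPred_and, ← Set.ofPred_or] at e₁
  simp only [h.adj_and_adj, ncard_setOf_map hT, ncard_setOf_map h.inj_left,
    ncard_setOf_map h.inj_right] at e₁
  have e₂ : {p : Fin 3 × Fin 3 | p.2 = p.1 + 1}.ncard = 3 := by
    rw [Set.ncard_eq_toFinset_card']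
    decide
  have e₃ := Set.ncard_union_add_ncard_inter (Set.range ι) (Set.range κ)
  have e₄ : Set.range ι ∪ Set.range κ = Set.univ := Set.eq_univ_of_forall h.cover
  have e₅ : Set.range ι ∩ Set.range κ = Set.range (ι ∘ t) := by
    ext p
    constructor
    · rintro ⟨⟨a, rfl⟩, ⟨b, hb⟩⟩
      obtain ⟨i, rfl, -⟩ := h.overlap hb.symm
      exact ⟨i, rfl⟩
    · rintro ⟨i, rfl⟩
      exact ⟨⟨t i, rfl⟩, ⟨τ i, (h.glue i).symm⟩⟩
  rw [e₄, e₅, Set.ncard_univ, ← Set.image_univ, ← Set.image_univ, ← Set.image_univ,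
    Set.ncard_image_of_injective _ hT, Set.ncard_image_of_injective _ h.inj_left,
    Set.ncard_image_of_injective _ h.inj_right, Set.ncard_univ, Set.ncard_univ, Set.ncard_univ,
    Nat.card_fin] at e₃
  have e₆ := h.left.card_arcs
  have e₇ := h.right.card_arcs
  change {p : X × X | Relation.Map D.Adj ι ι p.1 p.2 ∨ Relation.Map E.Adj κ κ p.1 p.2}.ncard + 6 =
    3 * Nat.card X
  omega

theorem isEulerianTriangulation [Finite X] (h : IsGluing D F E H ι κ t τ) :
    IsEulerianTriangulation (glueDigraph D E ι κ) (glueFace F H ι κ t τ) where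
  oriented := h.oriented
  rotate := h.rotate
  linked := h.linked
  exists_face := h.exists_face
  face_unique := h.face_unique
  link_connected := h.link_connected
  connected := h.connected
  balanced := h.balanced
  card_arcs := h.card_arcs

end IsGluing

end

/-! ### Restricting good sets to the two sides of a gluing -/

section

variable {V U X : Type*}

theorem IsAcyclicSet.preimage {D : Digraph V} {D' : Digraph X} {f : V → X} (hf : f.Injective)
    (hD : ∀ a b, D.Adj a b → D'.Adj (f a) (f b)) {A : Set X} (hA : IsAcyclicSet D' A) :
    IsAcyclicSet D (f ⁻¹' A) := by
  rintro ⟨c, hne, hnd, hcA, hch⟩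
  refine hA ⟨c.map f, fun h => hne ((Cycle.map_eq_nil f c).1 h), ?_, ?_,
    (Cycle.chain_map f).2 (hch.imp hD)⟩
  · induction c using Cycle.induction_on with
    | nil => exact Cycle.nodup_nil
    | cons a l _ =>
      rw [Cycle.map_coe, Cycle.nodup_coe_iff]
      exact (Cycle.nodup_coe_iff.1 hnd).map hf
  · intro v hv
    obtain ⟨a, ha, rfl⟩ := Cycle.mem_map.1 hv
    exact hcA a ha

/-- Connectedness passes to a part that meets the rest of the graph in pairwise linked vertices. -/
theorem subset_of_closed_preimage {D : Digraph V} {D' : Digraph X} {f : V → X} {P A : Set X}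
    {t : Fin 3 → V} (hf : f.Injective)
    (hsplit : ∀ {p q}, Linked D' p q →
      (∃ a b, Linked D a b ∧ f a = p ∧ f b = q) ∨ p ∈ P ∧ q ∈ P)
    (htri : ∀ {a}, f a ∈ P → ∃ i, a = t i) (hclique : ∀ {i j}, i ≠ j → Linked D (t i) (t j))
    (hA : ∀ S ⊆ A, S.Nonempty → (∀ u ∈ S, ∀ v ∈ A, Linked D' u v → v ∈ S) → A ⊆ S)
    {S : Set V} (hSA : S ⊆ f ⁻¹' A) (hS : S.Nonempty)
    (hcl : ∀ u ∈ S, ∀ v ∈ f ⁻¹' A, Linked D u v → v ∈ S) : f ⁻¹' A ⊆ S := by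
  have step : ∀ {i j}, t i ∈ S → f (t j) ∈ A → t j ∈ S := by
    intro i j hi hj
    by_cases hij : i = j
    · exact hij ▸ hi
    · exact hcl _ hi _ hj (hclique hij)
  -- Enlarge `S` by the part of `A` in `P` as soon as `S` meets the triangle; the clique makes this
  -- set closed in `A`.
  have key : A ⊆ {p | p ∈ A ∧ ((∃ a ∈ S, f a = p) ∨ (p ∈ P ∧ ∃ i, t i ∈ S))} := by
    refine hA _ (fun p hp => hp.1) ?_ ?_
    · obtain ⟨a, ha⟩ := hS
      exact ⟨f a, hSA ha, Or.inl ⟨a, ha, rfl⟩⟩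
    · rintro p ⟨hpA, hp⟩ q hqA hpq
      refine ⟨hqA, ?_⟩
      rcases hsplit hpq with ⟨a, b, hab, rfl, rfl⟩ | ⟨hpP, hqP⟩
      · have haS : a ∈ S := by
          rcases hp with ⟨a', ha', h⟩ | ⟨haP, i, hi⟩
          · exact hf h ▸ ha'
          · obtain ⟨j, rfl⟩ := htri haP
            exact step hi hpA
        exact Or.inl ⟨b, hcl a haS b hqA hab, rfl⟩
      · refine Or.inr ⟨hqP, ?_⟩
        rcases hp with ⟨a, ha, rfl⟩ | ⟨-, hi⟩
        · obtain ⟨i, rfl⟩ := htri hpP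
          exact ⟨i, ha⟩
        · exact hi
  intro a ha
  rcases (key ha).2 with ⟨a', ha', h⟩ | ⟨haP, i, hi⟩
  · exact hf h ▸ ha'
  · obtain ⟨j, rfl⟩ := htri haP
    exact step hi ha

namespace IsGluing

variable {D : Digraph V} {F : V → V → V → Prop} {E : Digraph U} {H : U → U → U → Prop}
  {ι : V → X} {κ : U → X} {t : Fin 3 → V} {τ : Fin 3 → U} {A : Set X}

/-- Off the triangle no link joins the two sides, so a connected set avoiding it lies on one side,
yet faces survive on both. -/
theorem exists_mem_triangle (h : IsGluing D F E H ι κ t τ)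
    (hA : IsGood (glueDigraph D E ι κ) (glueFace F H ι κ t τ) A) : ∃ i, ι (t i) ∈ A := by
  by_contra hno
  have hno' : ∀ {v u}, ι v = κ u → ι v ∉ A := by
    intro v u hvu hv
    obtain ⟨i, rfl, -⟩ := h.overlap hvu
    exact hno ⟨i, hv⟩
  obtain ⟨c, hc⟩ := h.exists_face_across_left 0
  have hl : (A ∩ Set.range ι).Nonempty := by
    rcases hA.permeating hc with hA | hA | hA <;> exact ⟨_, hA, _, rfl⟩
  have hsub : A ⊆ A ∩ Set.range ι := by
    refine hA.connected _ Set.inter_subset_left hl ?_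
    rintro _ ⟨hp, a, rfl⟩ q hq hlink
    rcases exists_of_linked hlink with ⟨a', b, -, -, rfl⟩ | ⟨a', b, -, ha, -⟩
    · exact ⟨hq, _, rfl⟩
    · exact absurd hp (hno' ha.symm)
  have hr : ∀ u, κ u ∉ A := by
    intro u hu
    obtain ⟨v, hv⟩ := (hsub hu).2
    exact hno' hv (hv ▸ hu)
  obtain ⟨c, hc⟩ := h.exists_face_across_right 0
  rcases hA.permeating hc with hA | hA | hA <;> exact hr _ hA

theorem isGood_left (h : IsGluing D F E H ι κ t τ)
    (hA : IsGood (glueDigraph D E ι κ) (glueFace F H ι κ t τ) A) : IsGood D F (ι ⁻¹' A) where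
  nonempty := by
    obtain ⟨i, hi⟩ := h.exists_mem_triangle hA
    exact ⟨t i, hi⟩
  connected S hSA hS hcl := by
    refine subset_of_closed_preimage (P := Set.range κ) (t := t) h.inj_left ?_ ?_
      (directed_triangle_linked h.arc_left) hA.connected hSA hS hcl
    · intro p q hpq
      rcases exists_of_linked hpq with hpq | ⟨a, b, -, rfl, rfl⟩
      · exact Or.inl hpq
      · exact Or.inr ⟨⟨a, rfl⟩, ⟨b, rfl⟩⟩
    · rintro a ⟨u, hu⟩
      obtain ⟨i, hi, -⟩ := h.overlap hu.symm
      exact ⟨i, hi⟩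
  acyclic := hA.acyclic.preimage h.inj_left fun _ _ => h.adj_left.2
  permeating {a b c} hf := by
    by_cases hn : ∃ i, a = t i ∧ b = t (i + 1) ∧ c = t (i + 2)
    -- The deleted face is not a face of the gluing; it is met because the set meets the shared
    -- triangle.
    · obtain ⟨i, rfl, rfl, rfl⟩ := hn
      obtain ⟨k, hk⟩ := h.exists_mem_triangle hA
      rcases fin_three_cases i k with rfl | rfl | ⟨rfl, -⟩
      · exact Or.inl hk
      · exact Or.inr (Or.inl hk)
      · exact Or.inr (Or.inr hk)
    · exact hA.permeating (Or.inl ⟨a, b, c, hf, hn, rfl, rfl, rfl⟩)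

theorem isGood_right (h : IsGluing D F E H ι κ t τ)
    (hA : IsGood (glueDigraph D E ι κ) (glueFace F H ι κ t τ) A) : IsGood E H (κ ⁻¹' A) where
  nonempty := by
    obtain ⟨i, hi⟩ := h.exists_mem_triangle hA
    rw [h.glue] at hi
    exact ⟨τ i, hi⟩
  connected S hSA hS hcl := by
    refine subset_of_closed_preimage (P := Set.range ι) (t := τ) h.inj_right ?_ ?_
      (directed_triangle_linked h.arc_right) hA.connected hSA hS hcl
    · intro p q hpq
      rcases exists_of_linked hpq with ⟨a, b, -, rfl, rfl⟩ | hpq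
      · exact Or.inr ⟨⟨a, rfl⟩, ⟨b, rfl⟩⟩
      · exact Or.inl hpq
    · rintro a ⟨u, hu⟩
      obtain ⟨i, -, hi⟩ := h.overlap hu
      exact ⟨i, hi⟩
  acyclic := hA.acyclic.preimage h.inj_right fun _ _ => h.adj_right.2
  permeating {a b c} hf := by
    by_cases hn : ∃ i, a = τ (i + 1) ∧ b = τ i ∧ c = τ (i + 2)
    · obtain ⟨i, rfl, rfl, rfl⟩ := hn
      obtain ⟨k, hk⟩ := h.exists_mem_triangle hA
      rw [h.glue] at hk
      rcases fin_three_cases i k with rfl | rfl | ⟨rfl, -⟩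
      · exact Or.inr (Or.inl hk)
      · exact Or.inl hk
      · exact Or.inr (Or.inr hk)
    · exact hA.permeating (Or.inr ⟨a, b, c, hf, hn, rfl, rfl, rfl⟩)

end IsGluing

end

/-! ### The 22-vertex gadget -/

section

/-- The neighbours of the vertices of the gadget in their cyclic order. -/
def gadgetRotation : Fin 22 → List (Fin 22) :=
  ![[1, 2, 9, 3], [0, 3, 19, 11, 13, 2], [0, 1, 13, 4, 21, 12, 15, 5, 18, 9], [0, 9, 14, 5, 17, 7, 16, 4, 19, 1],
    [2, 13, 11, 19, 3, 16, 8, 20, 6, 21], [2, 15, 6, 20, 8, 17, 3, 14, 10, 18], [4, 20, 5, 15, 12, 21], [3, 17, 8, 16],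
    [4, 16, 7, 17, 5, 20], [0, 2, 18, 10, 14, 3], [5, 14, 9, 18], [1, 19, 4, 13],
    [2, 21, 6, 15], [1, 11, 4, 2], [3, 9, 10, 5], [2, 12, 6, 5],
    [3, 7, 8, 4], [3, 5, 8, 7], [2, 5, 10, 9], [1, 3, 4, 11],
    [4, 8, 5, 6], [2, 4, 6, 12]]

/-- The out-neighbours of the vertices of the gadget. -/
def gadgetOut : Fin 22 → List (Fin 22) :=
  ![[1, 3], [2, 11, 13], [0, 5, 9, 12, 13], [1, 4, 7, 14, 16],
    [2, 6, 16, 19, 20], [3, 8, 10, 14, 15], [5, 12, 21], [8, 17],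
    [4, 17, 20], [0, 3, 18], [9, 18], [4, 19],
    [15, 21], [4, 11], [9, 10], [2, 6],
    [7, 8], [3, 5], [2, 5], [1, 3],
    [5, 6], [2, 4]]

/-- The colours of the vertices of the gadget. -/
def gadgetColour : Fin 22 → Fin 3 :=
  ![0, 1, 2, 2, 1, 1, 2, 1, 2, 1, 2, 2, 1, 0, 0, 0, 0, 0, 0, 0, 0, 0]

/-- An Eulerian oriented triangulation in which the sets of the theorem use one colour away from
a fixed facial triangle. -/
def gadget : Digraph (Fin 22) where
  Adj u v := v ∈ gadgetOut u

instance : DecidableRel gadget.Adj := fun u v => inferInstanceAs (Decidable (v ∈ gadgetOut u))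

instance (u v : Fin 22) : Decidable (Linked gadget u v) :=
  inferInstanceAs (Decidable (_ ∨ _))

/-- The neighbour of `v` that follows its neighbour `a` in the rotation at `v`. -/
def gadgetTurn (v a : Fin 22) : Option (Fin 22) :=
  ((gadgetRotation v).zip ((gadgetRotation v).rotate 1)).lookup a

/-- The facial triangles of the gadget. -/
def gadgetFace (a b c : Fin 22) : Prop :=
  gadgetTurn b a = some c

instance (a b c : Fin 22) : Decidable (gadgetFace a b c) :=
  inferInstanceAs (Decidable (_ = _))

theorem gadget_linked_iff {u v : Fin 22} : Linked gadget u v ↔ v ∈ gadgetRotation u := by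
  revert u v
  decide +kernel

theorem gadgetTurn_getElem (v : Fin 22) (i : Fin (gadgetRotation v).length) :
    gadgetTurn v ((gadgetRotation v)[i]) =
      (gadgetRotation v)[(i + 1) % (gadgetRotation v).length]? := by
  revert v
  decide +kernel

theorem mem_of_cyclically_closed {α : Type*} (l : List α) (S : Set α)
    (hcl : ∀ (i : ℕ) (hi : i < l.length), l[i] ∈ S →
      l[(i + 1) % l.length]'(Nat.mod_lt _ (by omega)) ∈ S)
    {a b : α} (ha : a ∈ l) (haS : a ∈ S) (hb : b ∈ l) : b ∈ S := by
  obtain ⟨i, hi, rfl⟩ := List.getElem_of_mem ha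
  obtain ⟨j, hj, rfl⟩ := List.getElem_of_mem hb
  have key : ∀ n, l[(i + n) % l.length]'(Nat.mod_lt _ (by omega)) ∈ S := by
    intro n
    induction n with
    | zero => simpa [Nat.mod_eq_of_lt hi] using haS
    | succ n ih =>
      have := hcl _ _ ih
      simpa [← add_assoc] using this
  -- Adding the length keeps the subtraction from truncating when `j < i`.
  have := key (j + l.length - i)
  rwa [getElem_congr_idx (show (i + (j + l.length - i)) % l.length = j by
    rw [show i + (j + l.length - i) = j + l.length by omega, Nat.add_mod_right,
      Nat.mod_eq_of_lt hj])] at this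

theorem isEulerianTriangulation_gadget : IsEulerianTriangulation gadget gadgetFace where
  oriented := by
    change ∀ u v, gadget.Adj u v → ¬ gadget.Adj v u
    decide +kernel
  rotate {a b c} habc := by
    have key : ∀ a b : Fin 22, ∀ c ∈ gadgetTurn b a, gadgetTurn c b = some a := by decide +kernel
    exact key a b c habc
  linked {a b c} habc := by
    have key : ∀ a b : Fin 22, (gadgetTurn b a).isSome → Linked gadget a b := by decide +kernel
    exact key a b (by rw [show gadgetTurn b a = some c from habc]; rfl)
  exists_face {a b} hab := by
    have key : ∀ a b : Fin 22, Linked gadget a b → (gadgetTurn b a).isSome := by decide +kernel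
    exact Option.isSome_iff_exists.1 (key a b hab)
  face_unique h₁ h₂ := Option.some.inj (h₁.symm.trans h₂)
  link_connected v S hS hcl a ha := by
    obtain ⟨b, hbS, hb⟩ := hS
    refine mem_of_cyclically_closed (gadgetRotation v) S ?_ (gadget_linked_iff.1 hb) hbS
      (gadget_linked_iff.1 ha)
    intro i hi hiS
    refine hcl _ _ ?_ hiS
    exact (gadgetTurn_getElem v ⟨i, hi⟩).trans (List.getElem?_eq_getElem _)
  connected S hS hcl := by
    -- Every vertex but 0 has a smaller neighbour: descend from any member to 0, then climb to every
    -- vertex.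
    have hlt : ∀ v : Fin 22, v ≠ 0 → ∃ u, u < v ∧ Linked gadget v u := by decide +kernel
    have hroot : ∀ v ∈ S, (0 : Fin 22) ∈ S := by
      intro v
      induction v using WellFoundedLT.induction with
      | _ v ih =>
      intro hv
      by_cases h0 : v = 0
      · exact h0 ▸ hv
      · obtain ⟨u, huv, hlink⟩ := hlt v h0
        exact ih u huv (hcl v hv u hlink)
    obtain ⟨w, hw⟩ := hS
    intro v
    induction v using WellFoundedLT.induction with
    | _ v ih =>
    by_cases h0 : v = 0
    · exact h0 ▸ hroot w hw
    · obtain ⟨u, huv, hlink⟩ := hlt v h0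
      exact hcl u (ih u huv) v hlink.symm
  balanced v := by
    rw [Set.ncard_eq_toFinset_card', Set.ncard_eq_toFinset_card']
    revert v
    decide +kernel
  card_arcs := by
    rw [Set.ncard_eq_toFinset_card', Nat.card_fin]
    decide +kernel

theorem IsAcyclicSet.not_four_cycle {V : Type*} {D : Digraph V} {A : Set V}
    (hA : IsAcyclicSet D A) {a b c d : V} (hne : [a, b, c, d].Nodup)
    (h : D.Adj a b ∧ D.Adj b c ∧ D.Adj c d ∧ D.Adj d a) :
    ¬ (a ∈ A ∧ b ∈ A ∧ c ∈ A ∧ d ∈ A) := by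
  intro hm
  refine hA ⟨([a, b, c, d] : List V), ?_, Cycle.nodup_coe_iff.2 hne, ?_, ?_⟩
  · exact fun h => List.cons_ne_nil _ _ ((Cycle.coe_eq_nil _).1 h)
  · intro v hv
    simp only [Cycle.mem_coe_iff, List.mem_cons, List.not_mem_nil, or_false] at hv
    rcases hv with rfl | rfl | rfl | rfl
    exacts [hm.1, hm.2.1, hm.2.2.1, hm.2.2.2]
  · simpa [Cycle.chain_coe_cons] using h

/-- If the link of `u` is the four-cycle `f a g b`, then a good set that avoids `f` and `g` cannot
avoid `a` and `b`, since otherwise it would be the singleton `u`. -/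
theorem IsGood.mem_or_mem {A : Set (Fin 22)} (hA : IsGood gadget gadgetFace A)
    {u a b f g : Fin 22} (hf : f ∉ A) (hg : g ∉ A) (hu : 2 < u) (hface : gadgetFace f u a)
    (hlink : ∀ v, Linked gadget u v → v = f ∨ v = a ∨ v = g ∨ v = b) : a ∈ A ∨ b ∈ A := by
  by_contra! hab
  have huA : u ∈ A := by
    rcases hA.permeating hface with h | h | h
    exacts [absurd h hf, h, absurd h hab.1]
  have hsub : A ⊆ {u} := by
    refine hA.connected {u} (Set.singleton_subset_iff.2 huA) ⟨u, rfl⟩ ?_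
    rintro _ rfl v hv hlv
    rcases hlink v hlv with rfl | rfl | rfl | rfl
    exacts [absurd hv hf, absurd hv hab.1, absurd hv hg, absurd hv hab.2]
  -- The singleton misses the outer face, because `2 < u`.
  have hout : gadgetFace 1 0 2 := by decide +kernel
  rcases hA.permeating hout with h | h | h <;>
  · obtain rfl := hsub h
    exact absurd hu (by decide)

/-- If all inner vertices of colour 0 are avoided, faces and links force either 2 and 3 or 4 and 5
into the set, and then every remaining choice completes a directed four-cycle. -/
theorem IsGood.exists_mem_gadget {A : Set (Fin 22)} (hA : IsGood gadget gadgetFace A) :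
    ∃ u ∈ A, 2 < u ∧ gadgetColour u = 0 := by
  by_contra! hno
  have hno' : ∀ u : Fin 22, 12 < u → u ∉ A := fun u hu hm => by
    have key : ∀ u : Fin 22, 12 < u → 2 < u ∧ gadgetColour u = 0 := by decide +kernel
    exact hno u hm (key u hu).1 (key u hu).2
  have cover : ∀ {f a b : Fin 22}, 12 < f → gadgetFace f a b → a ∈ A ∨ b ∈ A := by
    intro f a b hf hface
    rcases hA.permeating hface with h | h
    exacts [absurd h (hno' f hf), h]
  -- These four conditions say that the set contains both 2 and 3, or both 4 and 5.
  have e₁ : (3 : Fin 22) ∈ A ∨ (4 : Fin 22) ∈ A := cover (f := 16) (by decide) (by decide +kernel)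
  have e₂ : (3 : Fin 22) ∈ A ∨ (5 : Fin 22) ∈ A := cover (f := 14) (by decide) (by decide +kernel)
  have e₃ : (2 : Fin 22) ∈ A ∨ (4 : Fin 22) ∈ A := cover (f := 13) (by decide) (by decide +kernel)
  have e₄ : (2 : Fin 22) ∈ A ∨ (5 : Fin 22) ∈ A := cover (f := 15) (by decide) (by decide +kernel)
  -- Vertices 7, 11, 12 and 10 have degree four, with two avoided neighbours opposite each other in
  -- the link.
  have p₁ : (8 : Fin 22) ∈ A ∨ (3 : Fin 22) ∈ A := hA.mem_or_mem (u := 7) (f := 17) (g := 16)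
    (hno' _ (by decide)) (hno' _ (by decide)) (by decide) (by decide +kernel) (by decide +kernel)
  have p₂ : (4 : Fin 22) ∈ A ∨ (1 : Fin 22) ∈ A := hA.mem_or_mem (u := 11) (f := 19) (g := 13)
    (hno' _ (by decide)) (hno' _ (by decide)) (by decide) (by decide +kernel) (by decide +kernel)
  have p₃ : (6 : Fin 22) ∈ A ∨ (2 : Fin 22) ∈ A := hA.mem_or_mem (u := 12) (f := 21) (g := 15)
    (hno' _ (by decide)) (hno' _ (by decide)) (by decide) (by decide +kernel) (by decide +kernel)
  have p₄ : (9 : Fin 22) ∈ A ∨ (5 : Fin 22) ∈ A := hA.mem_or_mem (u := 10) (f := 14) (g := 18)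
    (hno' _ (by decide)) (hno' _ (by decide)) (by decide) (by decide +kernel) (by decide +kernel)
  -- With 2 and 3 the cycles are 3 → {1 or 4} → 2 → {5 or 9} → 3; with 4 and 5 they are 4 → {2 or 6}
  -- → 5 → {3 or 8} → 4. The cycle through 2, 3, 4 and 5 serves both cases.
  have c₁ := hA.acyclic.not_four_cycle (a := 3) (b := 1) (c := 2) (d := 5) (by decide) (by decide)
  have c₂ := hA.acyclic.not_four_cycle (a := 3) (b := 1) (c := 2) (d := 9) (by decide) (by decide)
  have c₃ := hA.acyclic.not_four_cycle (a := 3) (b := 4) (c := 2) (d := 5) (by decide) (by decide)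
  have c₄ := hA.acyclic.not_four_cycle (a := 3) (b := 4) (c := 2) (d := 9) (by decide) (by decide)
  have c₅ := hA.acyclic.not_four_cycle (a := 3) (b := 4) (c := 6) (d := 5) (by decide) (by decide)
  have c₆ := hA.acyclic.not_four_cycle (a := 2) (b := 5) (c := 8) (d := 4) (by decide) (by decide)
  have c₇ := hA.acyclic.not_four_cycle (a := 4) (b := 6) (c := 5) (d := 8) (by decide) (by decide)
  grind

end

/-! ### Iterated insertion of the gadget -/

section

/-- There is a properly coloured Eulerian oriented triangulation, with a facial triangle `t` that is
directed in the sense of its boundary walk, in which every good set has at least `n c` vertices of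
each colour `c`. -/
def ExistsTriangulation (n : Fin 3 → ℕ) : Prop :=
  ∃ (V : Type) (_ : Finite V) (D : Digraph V) (F : V → V → V → Prop) (col : V → Fin 3)
    (t : Fin 3 → V), IsEulerianTriangulation D F ∧ (∀ {a b}, D.Adj a b → col a ≠ col b) ∧
      (∀ i, D.Adj (t i) (t (i + 1))) ∧ (∀ i, F (t i) (t (i + 1)) (t (i + 2))) ∧
      ∀ A, IsGood D F A → ∀ c, n c ≤ (A ∩ {v | col v = c}).ncard

theorem gadgetColour_ne {a b : Fin 22} (h : gadget.Adj a b) : gadgetColour a ≠ gadgetColour b := by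
  revert a b
  decide +kernel

/-- Any coloured example with a suitably directed face starts the induction; the gadget with its
inner triangle 6, 12, 15 serves. -/
theorem existsTriangulation_zero : ExistsTriangulation 0 :=
  ⟨Fin 22, inferInstance, gadget, gadgetFace, gadgetColour, ![6, 12, 15],
    isEulerianTriangulation_gadget, gadgetColour_ne, by decide +kernel, by decide +kernel,
    fun _ _ _ => Nat.zero_le _⟩

/-- The outer triangle is traversed against its arcs, as needed to fit into a face traversed along
its arcs. -/
theorem gadget_outer (i : Fin 3) : gadget.Adj (Fin.castAdd 19 i) (Fin.castAdd 19 (i + 1)) ∧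
    gadgetFace (Fin.castAdd 19 (i + 1)) (Fin.castAdd 19 i) (Fin.castAdd 19 (i + 2)) ∧
    gadgetColour (Fin.castAdd 19 i) = i := by
  revert i
  decide +kernel

/-- The vertices of the gadget as vertices of the triangulation obtained by inserting it into the
face with boundary `t`. -/
def gadgetEmbedding {V : Type} (t : Fin 3 → V) : Fin 22 → V ⊕ Fin 19 :=
  Fin.append (m := 3) (n := 19) (fun i => Sum.inl (t i)) Sum.inr

section

variable {V : Type} (t : Fin 3 → V)

theorem gadgetEmbedding_castAdd (i : Fin 3) :
    gadgetEmbedding t (Fin.castAdd 19 i) = Sum.inl (t i) :=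
  Fin.append_left _ _ i

theorem gadgetEmbedding_natAdd (j : Fin 19) :
    gadgetEmbedding t (Fin.natAdd 3 j) = Sum.inr j :=
  Fin.append_right _ _ j

theorem fin_cases_gadget (u : Fin 22) :
    (∃ i : Fin 3, u = Fin.castAdd 19 i) ∨ ∃ j : Fin 19, u = Fin.natAdd 3 j := by
  refine Fin.addCases (m := 3) (n := 19) (motive := fun u => (∃ i : Fin 3, u = Fin.castAdd 19 i) ∨
    ∃ j : Fin 19, u = Fin.natAdd 3 j) (fun i => Or.inl ⟨i, rfl⟩) (fun j => Or.inr ⟨j, rfl⟩) u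

variable {t}

theorem isGluing_gadget {D : Digraph V} {F : V → V → V → Prop} (h : IsEulerianTriangulation D F)
    (ht : ∀ i, D.Adj (t i) (t (i + 1))) (hF : ∀ i, F (t i) (t (i + 1)) (t (i + 2))) :
    IsGluing D F gadget gadgetFace (Sum.inl : V → V ⊕ Fin 19) (gadgetEmbedding t) t
      (Fin.castAdd 19) where
  left := h
  right := isEulerianTriangulation_gadget
  inj_left := Sum.inl_injective
  inj_right := Fin.append_injective_iff.2
    ⟨Sum.inl_injective.comp (directed_triangle_injective h.oriented ht), Sum.inr_injective,
      fun _ _ => Sum.inl_ne_inr⟩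
  cover p := by
    rcases p with v | j
    · exact Or.inl ⟨v, rfl⟩
    · exact Or.inr ⟨_, gadgetEmbedding_natAdd t j⟩
  glue i := (gadgetEmbedding_castAdd t i).symm
  overlap {v u} hvu := by
    rcases fin_cases_gadget u with ⟨i, rfl⟩ | ⟨j, rfl⟩
    · rw [gadgetEmbedding_castAdd] at hvu
      exact ⟨i, Sum.inl_injective hvu, rfl⟩
    · rw [gadgetEmbedding_natAdd] at hvu
      exact absurd hvu Sum.inl_ne_inr
  arc_left := ht
  arc_right i := (gadget_outer i).1
  face_left := hF
  face_right i := (gadget_outer i).2.1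

end

/-- The gadget goes into the distinguished face with its colour 0 renamed to `c`; its forced inner
vertex is new, so the count of `c` grows by one. -/
theorem ExistsTriangulation.succ {n : Fin 3 → ℕ} (hn : ExistsTriangulation n) (c : Fin 3) :
    ExistsTriangulation (Function.update n c (n c + 1)) := by
  obtain ⟨V, _, D, F, col, t₀, h, hcol, ht₀, hF₀, hgood⟩ := hn
  -- Pairwise adjacent vertices have distinct colours, so all three colours occur on the triangle.
  obtain ⟨k, hk⟩ : ∃ k, col (t₀ k) = c := by
    refine Finite.surjective_of_injective (f := col ∘ t₀) ?_ c
    intro i j hij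
    by_contra hne
    rcases directed_triangle_linked ht₀ hne with h | h
    · exact hcol h hij
    · exact hcol h hij.symm
  obtain ⟨t, ht, hF, htc⟩ : ∃ t : Fin 3 → V, (∀ i, D.Adj (t i) (t (i + 1))) ∧
      (∀ i, F (t i) (t (i + 1)) (t (i + 2))) ∧ col (t 0) = c := by
    refine ⟨fun i => t₀ (i + k), fun i => ?_, fun i => ?_, by simpa using hk⟩
    · simpa only [add_right_comm] using ht₀ (i + k)
    · simpa only [add_right_comm] using hF₀ (i + k)
  have hg := isGluing_gadget h ht hF
  let col' : V ⊕ Fin 19 → Fin 3 :=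
    -- Gadget colour `i` becomes the colour of `t i`, so the colourings agree on the shared
    -- triangle.
    Sum.elim col fun j => col (t (gadgetColour (Fin.natAdd 3 j)))
  have hcol' : ∀ u, col' (gadgetEmbedding t u) = col (t (gadgetColour u)) := by
    intro u
    rcases fin_cases_gadget u with ⟨i, rfl⟩ | ⟨j, rfl⟩
    · rw [gadgetEmbedding_castAdd, (gadget_outer i).2.2]
      rfl
    · rw [gadgetEmbedding_natAdd]
      rfl
  -- The inner triangle avoids the outer one, so its face survives the gluing and becomes the new
  -- distinguished face.
  have hinner : ∀ i : Fin 3, gadget.Adj (![6, 12, 15] i) (![6, 12, 15] (i + 1)) ∧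
      gadgetFace (![6, 12, 15] i) (![6, 12, 15] (i + 1)) (![6, 12, 15] (i + 2)) ∧
      ∀ j : Fin 3, (![6, 12, 15] i : Fin 22) ≠ Fin.castAdd 19 j := by decide +kernel
  refine ⟨V ⊕ Fin 19, inferInstance, _, _, col', fun i => gadgetEmbedding t (![6, 12, 15] i),
    hg.isEulerianTriangulation, ?_, fun i => hg.adj_right.2 (hinner i).1, fun i => ?_, ?_⟩
  · rintro _ _ (⟨a, b, hab, rfl, rfl⟩ | ⟨a, b, hab, rfl, rfl⟩)
    · exact hcol hab
    · rw [hcol', hcol']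
      rcases directed_triangle_linked ht (gadgetColour_ne hab) with h | h
      · exact hcol h
      · exact (hcol h).symm
  · exact Or.inr ⟨_, _, _, (hinner i).2.1, fun ⟨j, hj, _⟩ => (hinner i).2.2 _ hj, rfl, rfl, rfl⟩
  · intro A hA d
    have hleft := hgood _ (hg.isGood_left hA) d
    have hinl : (Sum.inl '' ((Sum.inl ⁻¹' A : Set V) ∩ {v | col v = d}) : Set (V ⊕ Fin 19)) ⊆
        A ∩ {v | col' v = d} := by
      rintro _ ⟨v, ⟨hv, hvd⟩, rfl⟩
      exact ⟨hv, hvd⟩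
    rw [← Set.ncard_image_of_injective _ (Sum.inl_injective (β := Fin 19))] at hleft
    by_cases hd : d = c
    · subst hd
      rw [Function.update_self]
      obtain ⟨u, huA, hu2, hu0⟩ := (hg.isGood_right hA).exists_mem_gadget
      rcases fin_cases_gadget u with ⟨i, rfl⟩ | ⟨j, rfl⟩
      · exact absurd hu2 (Nat.not_lt.2 (Nat.le_of_lt_succ i.isLt))
      refine (Nat.succ_le_succ hleft).trans (Set.ncard_lt_ncard ⟨hinl, fun hsub => ?_⟩)
      have hj : gadgetEmbedding t (Fin.natAdd 3 j) ∈ A ∩ {v | col' v = d} :=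
        ⟨huA, by rw [Set.mem_ofPred_eq, hcol', hu0, htc]⟩
      obtain ⟨v, -, hv⟩ := hsub hj
      rw [gadgetEmbedding_natAdd] at hv
      exact Sum.inl_ne_inr hv
    · rw [Function.update_of_ne hd]
      exact hleft.trans (Set.ncard_le_ncard hinl)

theorem ExistsTriangulation.mono {m n : Fin 3 → ℕ} (hmn : m ≤ n) (hn : ExistsTriangulation n) :
    ExistsTriangulation m := by
  obtain ⟨V, hV, D, F, col, t, h, hcol, ht, hF, hgood⟩ := hn
  exact ⟨V, hV, D, F, col, t, h, hcol, ht, hF, fun A hA c => (hmn c).trans (hgood A hA c)⟩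

theorem existsTriangulation_const (n : ℕ) : ExistsTriangulation fun _ => n := by
  induction n with
  | zero => exact existsTriangulation_zero
  | succ n ih =>
    -- One insertion for each colour raises the common bound by one.
    refine (((ih.succ 0).succ 1).succ 2).mono fun c => ?_
    fin_cases c <;> simp [Function.update]

end

end OrientedPlane

theorem corollary11 (k : ℤ) :
    ∃ (V : Type) (_ : Finite V) (D : Digraph V)
      (R : RotationSystem D.toSimpleGraphInclusive)
      (C : D.toSimpleGraphInclusive.Coloring (Fin 3)),
      IsOriented D ∧ IsEulerian D ∧ R.IsPlanar ∧ R.IsTriangulation ∧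
        ∀ A : Set V, IsConnectedSet D A → IsAcyclicSet D A → R.IsPermeating A →
          ∀ i : Fin 3, k ≤ ((A ∩ C.colorClass i).ncard : ℤ) := by
  obtain ⟨V, hV, D, F, col, t, h, hcol, -, -, hgood⟩ := existsTriangulation_const k.toNat
  have : Nonempty V := ⟨t 0⟩
  refine ⟨V, hV, D, h.rotationSystem, SimpleGraph.Coloring.mk col ?_, h.oriented, h.isEulerian,
    h.isPlanar, h.isTriangulation, ?_⟩
  · intro a b hab
    rcases (toSimpleGraphInclusive_adj_iff h.oriented).1 hab with hab | hab
    · exact hcol hab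
    · exact (hcol hab).symm
  · intro A hc ha hp i
    exact Int.toNat_le.1 (hgood A (h.isGood hc ha hp) i)
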